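/- Let $K$ be an algebraically closed field and let $\mathcal{O}_1, \mathcal{O}_2$ be two non-trivial valuation rings on $K$ (i.e. $\mathcal{O}_i \neq K$) that are independent, meaning that they induce distinct topologies on $K$. Then the structure $(K,\mathcal{O}_1,\mathcal{O}_2)$ (in the language of rings with two unary predicates for $\mathcal{O}_1$ and $\mathcal{O}_2$) is not NIP; that is, it has the independence property: there is a formula $\varphi(\bar x;\bar y)$ such that for every $k$ there are tuples $\bar a_1,\dots,\bar a_k$ and $\bar b_S$ ($S\subseteq\{1,\dots,k\}$) in $K$ with $\varphi(\bar a_i;\bar b_S) \iff i\in S$. More precisely, let $\mathfrak{m}_i$ be the maximal ideal of $\mathcal{O}_i$, let $p$ be any prime number distinct from the characteristics of $K$, of $\mathcal{O}_1/\mathfrak{m}_1$ and of $\mathcal{O}_2/\mathfrak{m}_2$, and let $$W=\{u^p : u\in (1+\mathfrak{m}_1)\cap(1+\mathfrak{m}_2)\}.$$ Then the relation $x+y\in W$ (with $x$, $y$ single variables) is defined in $(K,\mathcal{O}_1,\mathcal{O}_2)$ by a first-order formula $\varphi(x;y)$ without parameters, and $\varphi$ has the independence property. -/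

import Mathlib

namespace MultiValued

universe u v w

section IndependenceProperty

variable (L : FirstOrder.Language.{u, v}) (M : Type w) [L.Structure M]

/-- A formula `φ(x; y)` without parameters (`x` an `m`-tuple and `y` an `n`-tuple of variables)
has the independence property in the structure `M` if for every `k` there are tuples `aᵢ` (`i < k`)
and tuples `b_S` (`S ⊆ {0, …, k - 1}`) in `M` such that `M ⊨ φ(aᵢ; b_S)` if and only if `i ∈ S`. -/
def FormulaHasIP {m n : ℕ} (φ : L.Formula (Fin m ⊕ Fin n)) : Prop :=
  ∀ k : ℕ, ∃ (a : Fin k → Fin m → M) (b : Set (Fin k) → Fin n → M),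
    ∀ (S : Set (Fin k)) (i : Fin k), φ.Realize (Sum.elim (a i) (b S)) ↔ i ∈ S

/-- `M` has the independence property: some formula `φ(x; y)` has it in `M`. -/
def HasIP : Prop :=
  ∃ (m n : ℕ) (φ : L.Formula (Fin m ⊕ Fin n)), FormulaHasIP L M φ

/-- `M` is NIP: no formula `φ(x; y)` has the independence property in `M`. -/
def IsNIP : Prop :=
  ∀ (m n : ℕ) (φ : L.Formula (Fin m ⊕ Fin n)), ¬ FormulaHasIP L M φ

end IndependenceProperty

section RingLanguage

/-- Relation symbols for two subsets: two unary predicates and nothing else. -/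
inductive ValRel : ℕ → Type
  | ring₁ : ValRel 1
  | ring₂ : ValRel 1

/-- The relational language with two unary predicates. -/
def valLanguage : FirstOrder.Language := ⟨fun _ => Empty, ValRel⟩

/-- The language of fields with two valuation rings: the language of rings together with
two unary predicates. -/
abbrev bivaluedLanguage : FirstOrder.Language := FirstOrder.Language.ring.sum valLanguage

variable {K : Type u} [Field K]

/-- The structure on `K` in the language with two unary predicates, naming `O₁` and `O₂`. -/
@[reducible] def valStructure (O₁ O₂ : ValuationSubring K) : valLanguage.Structure K where
  funMap := fun f => f.elim
  RelMap := fun {_} R =>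
    match R with
    | .ring₁ => fun x => x 0 ∈ O₁
    | .ring₂ => fun x => x 0 ∈ O₂

/-- The first-order structure `(K, O₁, O₂)`. -/
@[reducible] def bivaluedStructure (O₁ O₂ : ValuationSubring K) : bivaluedLanguage.Structure K :=
  letI : FirstOrder.Language.ring.Structure K := (FirstOrder.Ring.compatibleRingOfRing K).toStructure
  letI : valLanguage.Structure K := valStructure O₁ O₂
  FirstOrder.Language.sumStructure FirstOrder.Language.ring valLanguage K

end RingLanguage

section Valuations

variable {K : Type u} [Field K]

/-- The topology on `K` induced by the valuation ring `O`. -/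
@[reducible] noncomputable def valTopology (O : ValuationSubring K) : TopologicalSpace K :=
  O.valuation.subgroups_basis.topology

/-- Two (non-trivial) valuation rings are independent if they induce distinct topologies. -/
def Independent (O₁ O₂ : ValuationSubring K) : Prop :=
  valTopology O₁ ≠ valTopology O₂

/-- The coset `1 + 𝔪` in `K`, where `𝔪` is the maximal ideal of `O`. -/
def onePlusMaximalIdeal (O : ValuationSubring K) : Set K :=
  {u | ∃ a : O, a ∈ IsLocalRing.maximalIdeal O ∧ u = 1 + (a : K)}

/-- The set `W` of `p`th powers of elements of `(1 + 𝔪₁) ∩ (1 + 𝔪₂)`. -/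
def pthPowers (O₁ O₂ : ValuationSubring K) (p : ℕ) : Set K :=
  {w | ∃ u ∈ onePlusMaximalIdeal O₁ ∩ onePlusMaximalIdeal O₂, w = u ^ p}

end Valuations

end MultiValued

/-!
Fix distinct `a₁, …, aₖ` in `𝔪₁ ∩ 𝔪₂`, a primitive `p`th root of unity `ζ` and a set `S` of indices.
Consider the Kummer curve `yᵢᵖ = x + aᵢ` (`1 ≤ i ≤ k`). Suppose that `(x, y)` is a point on it with
all `yᵢ ∈ 1 + 𝔪₁`, with `yᵢ ∈ 1 + 𝔪₂` for `i ∈ S`, and with `yᵢ ∈ ζ (1 + 𝔪₂)` for `i ∉ S`. Then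
`aᵢ + x` is in `W` exactly when `i ∈ S`, because `1 + 𝔪` contains no nontrivial `p`th root of unity
(`eq_one_of_pow_eq_one`). So it suffices to find a point of the curve in the intersection of an open
set `Y₁` for the first topology with an open set `Y₂` for the second, both nonempty.

This is done by counting zeros of functions on the curve. A function is given by finitely many
coefficients `q`, and its norm to `K[x]` is a polynomial `kummerNorm a q` whose roots are the
`x`-coordinates of its zeros, away from ramification (`map_kummerNorm`), and whose degree is bounded
(`natDegree_kummerNorm_le`). The curve is irreducible, so that nonzero functions have nonzero norm
(`kummerNorm_ne_zero`). By linear algebra there is a nonzero function `A₁` with almost as many zeros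
in `Y₁` as the degree of the norm permits. Most of these zeros give simple roots of the norm, and a
simple root persists, together with the position of the zero over it, for all functions close to
`A₁` in the first topology (`exists_eventually_majority_roots`). The same holds for a function `A₂`
with most of its zeros in `Y₂`. By weak approximation (`Independent.exists_approx`), applied to each
coefficient, some function is close to `A₁` for the first topology and to `A₂` for the second. More
than half of the possible roots of its norm have only zeros in `Y₁` over them, and more than half
have only zeros in `Y₂` over them; a root of both kinds gives the point.
-/

section KummerCurve

open Polynomial Topology Filter

/-! ### Functions on a Kummer curve and their norms -/

section KummerNorm

variable {I : Type*} {p n : ℕ}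

/-- The polynomial `∑ⱼ q(e, j) Xʲ`, the coefficient of the monomial `y^e` in the function on the
Kummer curve `yᵢᵖ = X + aᵢ` with coefficient vector `q`. Exponents `e` live in `I → ZMod p`, as
higher powers of the `yᵢ` are redundant. -/
noncomputable def kummerCoeff {S : Type*} [CommRing S] (q : (I → ZMod p) × Fin n → S)
    (e : I → ZMod p) : S[X] :=
  ∑ j, C (q (e, j)) * X ^ (j : ℕ)

theorem kummerCoeff_map {S S' : Type*} [CommRing S] [CommRing S'] (f : S →+* S')
    (q : (I → ZMod p) × Fin n → S) (e : I → ZMod p) :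
    kummerCoeff (fun t => f (q t)) e = (kummerCoeff q e).map f := by
  simp [kummerCoeff, Polynomial.map_sum]

theorem natDegree_kummerCoeff_le {S : Type*} [CommRing S] (q : (I → ZMod p) × Fin n → S)
    (e : I → ZMod p) : (kummerCoeff q e).natDegree ≤ n - 1 := by
  refine natDegree_sum_le_of_forall_le _ _ fun j _ => ?_
  exact (natDegree_C_mul_X_pow_le _ _).trans (by omega)

/-- The tuple of `p`th roots obtained from `y` by multiplying `yᵢ` by `ζ ^ fᵢ`. If `ζ` is a
primitive `p`th root of unity, these are, as `f` varies, all the points of the Kummer curve over the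
same `X` as `y`. -/
def rootTwist {E : Type*} [CommRing E] (ζ : E) (f : I → ZMod p) (y : I → E) : I → E :=
  fun i => ζ ^ (f i).val * y i

theorem rootTwist_zero {E : Type*} [CommRing E] (ζ : E) (y : I → E) :
    rootTwist ζ (0 : I → ZMod p) y = y := by
  ext i
  simp [rootTwist]

theorem rootTwist_pow {E : Type*} [CommRing E] {ζ : E} (hζ : ζ ^ p = 1) (f : I → ZMod p)
    (y : I → E) (i : I) : rootTwist ζ f y i ^ p = y i ^ p := by
  rw [rootTwist, mul_pow, ← pow_mul, mul_comm (f i).val, pow_mul, hζ, one_pow, one_mul]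

theorem sum_pow_val [NeZero p] {E : Type*} [Field E] [DecidableEq E] {w : E} (hw : w ^ p = 1) :
    ∑ e : ZMod p, w ^ e.val = if w = 1 then (p : E) else 0 := by
  have h : ∑ e : ZMod p, w ^ e.val = ∑ i ∈ Finset.range p, w ^ i := by
    rw [← Fin.sum_univ_eq_sum_range]
    obtain ⟨m, rfl⟩ : ∃ m, p = m + 1 := ⟨p - 1, by have := NeZero.pos p; omega⟩
    rfl
  rw [h]
  split_ifs with h1
  · simp [h1]
  · rw [geom_sum_eq h1, hw]; simp

variable [Fintype I]

/-- The matrix, in the basis of the monomials `y^e`, of multiplication by `∑ₑ kummerCoeff q e • y^e`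
on the algebra `S[X][yᵢ] / (yᵢᵖ - X - aᵢ)`. The entry at `(e, e')` is the coefficient of
`y^(e - e')`, times a factor `X + aᵢ` for each `i` where the exponents of `y^(e - e')` and `y^e'`
add up to at least `p`. -/
noncomputable def kummerMatrix {S : Type*} [CommRing S] (a : I → S)
    (q : (I → ZMod p) × Fin n → S) : Matrix (I → ZMod p) (I → ZMod p) S[X] :=
  Matrix.of fun e e' => kummerCoeff q (e - e') *
    ∏ i, if p ≤ ((e - e') i).val + (e' i).val then X + C (a i) else 1

/-- The monomial `y^e = ∏ᵢ yᵢ ^ eᵢ`, with exponents represented in `[0, p)`. -/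
def kummerMonomial {E : Type*} [CommRing E] (y : I → E) (e : I → ZMod p) : E :=
  ∏ i, y i ^ (e i).val

theorem kummerMonomial_add [NeZero p] {E : Type*} [CommRing E] (y : I → E) (g e : I → ZMod p) :
    kummerMonomial y (g + e) *
      (∏ i, if p ≤ (g i).val + (e i).val then y i ^ p else 1) =
      kummerMonomial y g * kummerMonomial y e := by
  simp only [kummerMonomial, ← Finset.prod_mul_distrib]
  refine Finset.prod_congr rfl fun i _ => ?_
  split_ifs with h
  · rw [← pow_add, ← pow_add, Pi.add_apply, ZMod.val_add_val_of_le h]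
  · rw [Pi.add_apply, ZMod.val_add_of_lt (not_le.mp h), mul_one, pow_add]

variable [DecidableEq I] [NeZero p]

/-- The norm to `S[X]` of the function on the Kummer curve `yᵢᵖ = X + aᵢ` with coefficients `q`, as
the determinant of multiplication by that function. -/
noncomputable def kummerNorm {S : Type*} [CommRing S] (a : I → S)
    (q : (I → ZMod p) × Fin n → S) : S[X] :=
  (kummerMatrix a q).det

/-- The value of the function with coefficients `q` at the point `y` over the ring homomorphism
`φ : S[X] → E`. For `φ` the evaluation at `c`, this is the value at the point `(c, y)`. -/
noncomputable def kummerValue {S E : Type*} [CommRing S] [CommRing E] (φ : S[X] →+* E)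
    (q : (I → ZMod p) × Fin n → S) (y : I → E) : E :=
  ∑ e, φ (kummerCoeff q e) * kummerMonomial y e

theorem kummerNorm_map {S S' : Type*} [CommRing S] [CommRing S'] (f : S →+* S') (a : I → S)
    (q : (I → ZMod p) × Fin n → S) :
    kummerNorm (fun i => f (a i)) (fun t => f (q t)) = (kummerNorm a q).map f := by
  rw [kummerNorm, kummerNorm, ← Polynomial.coe_mapRingHom, RingHom.map_det]
  congr 1
  ext1 e e'
  simp only [kummerMatrix, Matrix.of_apply, RingHom.mapMatrix_apply, Matrix.map_apply,
    kummerCoeff_map, coe_mapRingHom, Polynomial.map_mul, Polynomial.map_prod]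
  congr 1
  refine Finset.prod_congr rfl fun i _ => ?_
  split_ifs <;> simp

theorem natDegree_kummerNorm_le {S : Type*} [CommRing S] [Nontrivial S] (a : I → S)
    (q : (I → ZMod p) × Fin n → S) :
    (kummerNorm a q).natDegree ≤ p ^ Fintype.card I * (n - 1 + Fintype.card I) := by
  have h : ∀ e e', (kummerMatrix a q e e').natDegree ≤ n - 1 + Fintype.card I := by
    intro e e'
    refine natDegree_mul_le.trans (add_le_add (natDegree_kummerCoeff_le _ _) ?_)
    refine (natDegree_prod_le _ _).trans ?_
    refine (Finset.sum_le_card_nsmul _ _ 1 fun i _ => ?_).trans (by simp)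
    split_ifs
    · exact (natDegree_X_add_C _).le
    · simp
  rw [kummerNorm, Matrix.det_apply]
  refine natDegree_sum_le_of_forall_le _ _ fun σ _ => ?_
  refine (natDegree_smul_le _ _).trans ((natDegree_prod_le _ _).trans ?_)
  refine (Finset.sum_le_card_nsmul _ _ _ fun i _ => h _ _).trans ?_
  simp [ZMod.card]

/-- The vector of monomials `y^e` is a left eigenvector of the multiplication matrix; the eigenvalue
is the value of the function at `y`. -/
theorem sum_kummerMonomial_mul_kummerMatrix {S E : Type*} [CommRing S] [CommRing E]
    (φ : S[X] →+* E) (a : I → S) (q : (I → ZMod p) × Fin n → S) (y : I → E)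
    (hy : ∀ i, y i ^ p = φ (X + C (a i))) (e' : I → ZMod p) :
    ∑ e, kummerMonomial y e * φ (kummerMatrix a q e e') =
      kummerValue φ q y * kummerMonomial y e' := by
  rw [← Equiv.sum_comp (Equiv.addRight e'), kummerValue, Finset.sum_mul]
  refine Finset.sum_congr rfl fun g _ => ?_
  rw [mul_assoc, ← kummerMonomial_add]
  simp only [Equiv.coe_addRight, kummerMatrix, Matrix.of_apply, add_sub_cancel_right, map_mul,
    map_prod]
  rw [mul_left_comm]
  congr 2
  refine Finset.prod_congr rfl fun i _ => ?_
  split_ifs <;> simp [hy]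

/-- The matrix whose rows are the vectors of monomials at the points `rootTwist ζ f y`. -/
def branchMatrix {E : Type*} [CommRing E] (ζ : E) (y : I → E) :
    Matrix (I → ZMod p) (I → ZMod p) E :=
  Matrix.of fun f e => kummerMonomial (rootTwist ζ f y) e

theorem det_branchMatrix_ne_zero {E : Type*} [Field E] {ζ : E} (hζ : IsPrimitiveRoot ζ p)
    {y : I → E} (hy : ∀ i, y i ≠ 0) : (branchMatrix (p := p) ζ y).det ≠ 0 := by
  classical
  have hζ0 : ζ ≠ 0 := hζ.ne_zero (NeZero.ne p)
  have hp : (p : E) ≠ 0 := (hζ.neZero').ne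
  -- orthogonality of the characters of `(ZMod p)^I` gives the inverse up to a scalar
  have key : branchMatrix (p := p) ζ y *
      (Matrix.of fun e f => (kummerMonomial (rootTwist ζ f y) e)⁻¹) =
        ((p : E) ^ Fintype.card I) • (1 : Matrix (I → ZMod p) (I → ZMod p) E) := by
    ext f f'
    have h1 : ∀ e : I → ZMod p,
        kummerMonomial (rootTwist ζ f y) e * (kummerMonomial (rootTwist ζ f' y) e)⁻¹ =
          ∏ i, (ζ ^ (f i).val / ζ ^ (f' i).val) ^ (e i).val := by
      intro e
      rw [kummerMonomial, kummerMonomial, ← div_eq_mul_inv, ← Finset.prod_div_distrib]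
      refine Finset.prod_congr rfl fun i _ => ?_
      rw [← div_pow, rootTwist, rootTwist, mul_div_mul_right _ _ (hy i)]
    have h2 : ∀ i, ∑ e : ZMod p, (ζ ^ (f i).val / ζ ^ (f' i).val) ^ e.val =
        if f i = f' i then (p : E) else 0 := by
      intro i
      rw [sum_pow_val (by rw [div_pow, ← pow_mul, ← pow_mul, mul_comm, pow_mul, mul_comm (f' i).val,
        pow_mul, hζ.pow_eq_one, one_pow, one_pow, div_one])]
      refine if_congr ?_ rfl rfl
      rw [div_eq_one_iff_eq (pow_ne_zero _ hζ0)]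
      refine ⟨fun h => ZMod.val_injective p (hζ.pow_inj (ZMod.val_lt _) (ZMod.val_lt _) h), ?_⟩
      rintro h
      rw [h]
    rw [Matrix.mul_apply]
    simp only [branchMatrix, Matrix.of_apply, h1]
    have h3 := Finset.prod_univ_sum (fun _ : I => (Finset.univ : Finset (ZMod p)))
      (fun i e => (ζ ^ (f i).val / ζ ^ (f' i).val) ^ e.val)
    rw [Fintype.piFinset_univ] at h3
    rw [← h3, Finset.prod_congr rfl fun i _ => h2 i, Matrix.smul_apply, Matrix.one_apply]
    by_cases hf : f = f'
    · simp [hf]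
    · obtain ⟨i, hi⟩ := Function.ne_iff.mp hf
      rw [if_neg hf, smul_zero]
      exact Finset.prod_eq_zero (Finset.mem_univ i) (if_neg hi)
  intro h0
  have := congrArg Matrix.det key
  rw [Matrix.det_mul, h0, zero_mul, Matrix.det_smul, Matrix.det_one, mul_one] at this
  exact pow_ne_zero _ (pow_ne_zero _ hp) this.symm

/-- The norm of a function is the product of its values at the points over a given `X`, away from
ramification. -/
theorem map_kummerNorm {S E : Type*} [CommRing S] [Field E]
    (φ : S[X] →+* E) (a : I → S) (q : (I → ZMod p) × Fin n → S) {y : I → E}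
    (hy : ∀ i, y i ^ p = φ (X + C (a i))) (hy0 : ∀ i, y i ≠ 0) {ζ : E}
    (hζ : IsPrimitiveRoot ζ p) :
    φ (kummerNorm a q) = ∏ f : I → ZMod p, kummerValue φ q (rootTwist ζ f y) := by
  have h : branchMatrix (p := p) ζ y * φ.mapMatrix (kummerMatrix a q) =
      Matrix.diagonal (fun f => kummerValue φ q (rootTwist ζ f y)) * branchMatrix ζ y := by
    ext f e'
    rw [Matrix.mul_apply, Matrix.diagonal_mul]
    exact sum_kummerMonomial_mul_kummerMatrix φ a q _
      (fun i => (rootTwist_pow hζ.pow_eq_one f y i).trans (hy i)) e'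
  have h' := congrArg Matrix.det h
  rw [Matrix.det_mul, Matrix.det_mul, mul_comm, Matrix.det_diagonal, ← RingHom.map_det] at h'
  exact mul_right_cancel₀ (det_branchMatrix_ne_zero hζ hy0) h'

theorem pow_card_dvd_det {m : Type*} [Fintype m] [DecidableEq m] {R : Type*} [CommRing R]
    (N : Matrix m m R) (s : Finset m) (g : R) (h : ∀ i ∈ s, ∀ j, g ∣ N i j) :
    g ^ s.card ∣ N.det := by
  classical
  have h' : ∀ i j, ∃ t, N i j = (if i ∈ s then g else 1) * t := by
    intro i j
    split_ifs with hi
    · exact h i hi j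
    · exact ⟨N i j, (one_mul _).symm⟩
  choose N' hN' using h'
  have : N = Matrix.diagonal (fun i => if i ∈ s then g else 1) * Matrix.of N' := by
    ext i j
    rw [Matrix.diagonal_mul]
    exact hN' i j
  rw [this, Matrix.det_mul, Matrix.det_diagonal, Finset.prod_ite_mem, Finset.univ_inter,
    Finset.prod_const]
  exact dvd_mul_right _ _

/-- The order of vanishing of the norm at `c` is at least the number of points over `c` at which the
function vanishes. -/
theorem pow_card_dvd_kummerNorm {K : Type*} [Field K] (a : I → K)
    (q : (I → ZMod p) × Fin n → K) (c : K) {y : I → K}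
    (hy : ∀ i, y i ^ p = c + a i) (hy0 : ∀ i, y i ≠ 0) {ζ : K} (hζ : IsPrimitiveRoot ζ p)
    (s : Finset (I → ZMod p))
    (hs : ∀ f ∈ s, kummerValue (evalRingHom c) q (rootTwist ζ f y) = 0) :
    (X - C c) ^ s.card ∣ kummerNorm a q := by
  -- in the basis of rows given by the points over `c`, the rows of vanishing points vanish at `c`
  have h : (X - C c) ^ s.card ∣
      ((branchMatrix (p := p) ζ y).map C * kummerMatrix a q).det := by
    refine pow_card_dvd_det _ s _ fun f hf e' => ?_
    have := sum_kummerMonomial_mul_kummerMatrix (evalRingHom c) a q (rootTwist ζ f y)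
      (fun i => by rw [rootTwist_pow hζ.pow_eq_one, hy]; simp) e'
    rw [dvd_iff_isRoot, IsRoot.def, Matrix.mul_apply, eval_finsetSum]
    rw [hs f hf, zero_mul] at this
    simpa [branchMatrix] using this
  rw [Matrix.det_mul] at h
  have hu : IsUnit ((branchMatrix (p := p) ζ y).map C : Matrix _ _ K[X]).det := by
    have : ((branchMatrix (p := p) ζ y).map C : Matrix _ _ K[X]).det =
      C (branchMatrix (p := p) ζ y).det := (RingHom.map_det C _).symm
    rw [this]
    exact (isUnit_iff_ne_zero.mpr (det_branchMatrix_ne_zero hζ hy0)).map C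
  exact (hu.dvd_mul_left).mp h

theorem eval_kummerNorm_eq_zero {K : Type*} [Field K] {a : I → K}
    {q : (I → ZMod p) × Fin n → K} {c : K} {y : I → K}
    (hy : ∀ i, y i ^ p = c + a i) (hy0 : ∀ i, y i ≠ 0) {ζ : K} (hζ : IsPrimitiveRoot ζ p)
    (h : kummerValue (evalRingHom c) q y = 0) : (kummerNorm a q).eval c = 0 := by
  have hd := pow_card_dvd_kummerNorm a q c hy hy0 hζ {0} (by
    intro g hg
    rw [Finset.mem_singleton.mp hg, rootTwist_zero, h])
  rwa [Finset.card_singleton, pow_one, dvd_iff_isRoot] at hd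

end KummerNorm

/-! ### Irreducibility of the Kummer curve -/

/-- Kummer theory: `p`th roots of elements of a field `F` containing the `p`th roots of unity are
linearly independent over `F` if no two of them have their ratio in `F`. They are eigenvectors of
the Galois group for distinct characters, so this is the independence of characters. -/
theorem linearIndependent_of_pow_mem_range {F L ι : Type*} [Field F] [Field L] [Algebra F L]
    [IsGalois F L] {p : ℕ} [NeZero p] {ζ : F} (hζ : IsPrimitiveRoot ζ p) {w : ι → L}
    (hw0 : ∀ e, w e ≠ 0) (hw : ∀ e, ∃ r : F, w e ^ p = algebraMap F L r)
    (hne : ∀ e e', e ≠ e' → ∀ r : F, w e ≠ algebraMap F L r * w e') :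
    LinearIndependent F w := by
  have hζL : IsPrimitiveRoot (algebraMap F L ζ) p := hζ.map_of_injective (algebraMap F L).injective
  have hfix : ∀ (e : ι) (σ τ : L ≃ₐ[F] L), τ (σ (w e) / w e) = σ (w e) / w e := by
    intro e σ τ
    obtain ⟨r, hr⟩ := hw e
    have h1 : (σ (w e) / w e) ^ p = 1 := by
      rw [div_pow, ← map_pow, hr, AlgEquiv.commutes, div_self]
      rw [← hr]
      exact pow_ne_zero _ (hw0 e)
    obtain ⟨i, -, hi⟩ := hζL.eq_pow_of_pow_eq_one h1
    rw [← hi, map_pow, AlgEquiv.commutes]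
  let χ : ι → (L ≃ₐ[F] L) →* L := fun e =>
    { toFun := fun σ => σ (w e) / w e
      map_one' := by simp [hw0 e]
      map_mul' := by
        intro σ τ
        have h := hfix e τ σ
        rw [map_div₀, div_eq_iff ((map_ne_zero σ).mpr (hw0 e))] at h
        rw [AlgEquiv.mul_apply, h, mul_div_assoc, mul_comm] }
  have hχ : Function.Injective χ := by
    intro e e' h
    by_contra hee
    have hmem : w e / w e' ∈ Set.range (algebraMap F L) := by
      rw [InfiniteGalois.mem_range_algebraMap_iff_fixed]
      intro σ
      have h1 : σ (w e) / w e = σ (w e') / w e' := DFunLike.congr_fun h σ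
      rw [map_div₀, div_eq_div_iff ((map_ne_zero σ).mpr (hw0 e')) (hw0 e')]
      rw [div_eq_div_iff (hw0 e) (hw0 e')] at h1
      rw [h1, mul_comm]
    obtain ⟨r, hr⟩ := hmem
    exact hne e e' hee r (by rw [hr, div_mul_cancel₀ _ (hw0 e')])
  have hli : LinearIndependent L fun e => (χ e : (L ≃ₐ[F] L) → L) :=
    (linearIndependent_monoidHom (L ≃ₐ[F] L) L).comp χ hχ
  rw [linearIndependent_iff'] at hli ⊢
  intro s g hg e he
  have := hli s (fun e => algebraMap F L (g e) * w e) (by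
    ext σ
    have h := congrArg σ hg
    rw [map_sum, map_zero] at h
    rw [Finset.sum_apply, Pi.zero_apply, ← h]
    refine Finset.sum_congr rfl fun e _ => ?_
    change algebraMap F L (g e) * w e * (σ (w e) / w e) = _
    rw [Algebra.smul_def, map_mul, AlgEquiv.commutes, mul_assoc, mul_div_cancel₀ _ (hw0 e)]) e he
  exact (map_eq_zero _).mp ((mul_eq_zero.mp this).resolve_right (hw0 e))

section

variable {I : Type*} [Fintype I] {p n : ℕ} {K : Type*} [Field K]

theorem kummerMonomial_pow {E : Type*} [CommRing E] (y : I → E) (e : I → ZMod p) :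
    kummerMonomial y e ^ p = ∏ i, (y i ^ p) ^ (e i).val := by
  simp only [kummerMonomial, ← Finset.prod_pow, ← pow_mul, mul_comm]

theorem rootMultiplicity_pow_mul_prod [DecidableEq I] {a : I → K} (ha : Function.Injective a)
    {P : K[X]} (hP : P ≠ 0) (e : I → ℕ) (i : I) :
    (P ^ p * ∏ j, (X + C (a j)) ^ e j).rootMultiplicity (-a i) =
      p * P.rootMultiplicity (-a i) + e i := by
  have h0 : ∀ j, X + C (a j) ≠ 0 := fun j => X_add_C_ne_zero _
  have h1 : ∏ j, (X + C (a j)) ^ e j ≠ 0 :=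
    Finset.prod_ne_zero_iff.mpr fun j _ => pow_ne_zero _ (h0 j)
  classical
  rw [← count_roots, roots_mul (mul_ne_zero (pow_ne_zero _ hP) h1), roots_pow,
    Multiset.count_add, Multiset.count_nsmul, count_roots,
    roots_prod (fun j => (X + C (a j)) ^ e j) Finset.univ h1, Multiset.count_bind]
  have h2 : ∀ j, ((X + C (a j)) ^ e j).roots.count (-a i) = if j = i then e i else 0 := by
    intro j
    rw [roots_pow, roots_X_add_C, Multiset.count_nsmul, Multiset.count_singleton]
    by_cases hj : j = i
    · simp [hj]
    · rw [if_neg hj, if_neg (fun h => hj (ha (neg_injective h)).symm), mul_zero]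
  simp only [h2]
  simp

/-- The class of `∏ (X + aⱼ) ^ eⱼ` modulo `p`th powers determines the exponents modulo `p`: compare
the orders at `-aᵢ`. -/
theorem pow_mul_prod_injective [NeZero p] {a : I → K} (ha : Function.Injective a)
    {P Q : K[X]} (hP : P ≠ 0) (hQ : Q ≠ 0) {e e' : I → ZMod p}
    (h : P ^ p * ∏ j, (X + C (a j)) ^ (e j).val = Q ^ p * ∏ j, (X + C (a j)) ^ (e' j).val) :
    e = e' := by
  classical
  ext i
  have := congrArg (rootMultiplicity (-a i)) h
  rw [rootMultiplicity_pow_mul_prod ha hP (fun j => (e j).val),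
    rootMultiplicity_pow_mul_prod ha hQ (fun j => (e' j).val)] at this
  have h2 := congrArg (fun m : ℕ => (m : ZMod p)) this
  simpa using h2

/-- Irreducibility of the Kummer curve, in the form needed here: a nonzero function has nonzero
norm. The monomials `y^e` in a separable closure of `K(X)` are independent over `K(X)`, so that no
conjugate of the function vanishes. -/
theorem kummerNorm_ne_zero [DecidableEq I] [NeZero p] {ζ : K} (hζ : IsPrimitiveRoot ζ p)
    {a : I → K} (ha : Function.Injective a) {q : (I → ZMod p) × Fin n → K} (hq : q ≠ 0) :
    kummerNorm a q ≠ 0 := by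
  let F := RatFunc K
  let L := SeparableClosure F
  let φ : K[X] →+* L := (algebraMap F L).comp (algebraMap K[X] F)
  have hφ : Function.Injective φ :=
    (algebraMap F L).injective.comp (IsFractionRing.injective K[X] F)
  have hζF : IsPrimitiveRoot (algebraMap K[X] F (C ζ)) p :=
    hζ.map_of_injective (f := (algebraMap K[X] F).comp C)
      ((IsFractionRing.injective K[X] F).comp C_injective)
  have hζL : IsPrimitiveRoot (algebraMap F L (algebraMap K[X] F (C ζ))) p :=
    hζF.map_of_injective (algebraMap F L).injective
  have : NeZero (p : L) := hζL.neZero'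
  have hroot : ∀ i, ∃ y : L, y ^ p = φ (X + C (a i)) := fun i =>
    IsSepClosed.exists_pow_nat_eq _ p
  choose y hy using hroot
  have hφ0 : ∀ i, φ (X + C (a i)) ≠ 0 := fun i =>
    (map_ne_zero_iff φ hφ).mpr (X_add_C_ne_zero _)
  have key : ∀ y : I → L, (∀ i, y i ^ p = φ (X + C (a i))) → kummerValue φ q y ≠ 0 := by
    intro y hy h0
    have hy0 : ∀ i, y i ≠ 0 := fun i h => hφ0 i (by rw [← hy i, h, zero_pow (NeZero.ne p)])
    have hw0 : ∀ e : I → ZMod p, kummerMonomial y e ≠ 0 := fun e =>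
      Finset.prod_ne_zero_iff.mpr fun i _ => pow_ne_zero _ (hy0 i)
    have hwp : ∀ e : I → ZMod p,
        kummerMonomial y e ^ p = φ (∏ i, (X + C (a i)) ^ (e i).val) := by
      intro e
      rw [kummerMonomial_pow, map_prod]
      exact Finset.prod_congr rfl fun i _ => by rw [hy, map_pow]
    have hli : LinearIndependent F (kummerMonomial y : (I → ZMod p) → L) := by
      refine linearIndependent_of_pow_mem_range hζF hw0 (fun e => ⟨_, hwp e⟩) ?_
      intro e e' hne r hr
      have hr0 : r ≠ 0 := by
        rintro rfl
        rw [map_zero, zero_mul] at hr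
        exact hw0 e hr
      obtain ⟨P, Q, hQ, rfl⟩ := IsFractionRing.div_surjective (A := K[X]) r
      have hQ0 : Q ≠ 0 := nonZeroDivisors.ne_zero hQ
      have hP0 : P ≠ 0 := by
        rintro rfl
        simp at hr0
      have hQφ : φ Q ≠ 0 := (map_ne_zero_iff φ hφ).mpr hQ0
      have h1 : φ Q * kummerMonomial y e = φ P * kummerMonomial y e' := by
        rw [hr, map_div₀]
        change φ Q * (φ P / φ Q * _) = _
        rw [← mul_assoc, mul_div_cancel₀ _ hQφ]
      have h2 := congrArg (· ^ p) h1
      simp only [mul_pow, hwp, ← map_pow, ← map_mul] at h2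
      exact hne (pow_mul_prod_injective ha hQ0 hP0 (hφ h2))
    have hc := Fintype.linearIndependent_iff.mp hli
      (fun e => algebraMap K[X] F (kummerCoeff q e)) (by
        rw [← h0, kummerValue]
        exact Finset.sum_congr rfl fun e _ => Algebra.smul_def _ _)
    apply hq
    ext ⟨e, j⟩
    have h3 : kummerCoeff q e = 0 := (IsFractionRing.injective K[X] F) (by rw [hc e, map_zero])
    have h4 := congrArg (coeff · (j : ℕ)) h3
    simpa [kummerCoeff, finsetSum_coeff, coeff_X_pow, Fin.val_inj] using h4
  intro h0
  have hy0 : ∀ i, y i ≠ 0 := fun i h => hφ0 i (by rw [← hy i, h, zero_pow (NeZero.ne p)])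
  have h1 := map_kummerNorm φ a q hy hy0 hζL
  rw [h0, map_zero] at h1
  refine Finset.prod_ne_zero_iff.mpr (fun f _ => key _ fun i => ?_) h1.symm
  rw [rootTwist_pow hζL.pow_eq_one, hy]

end

/-! ### Persistence of zeros under small changes of the function -/

theorem IsPrimitiveRoot.pow_sub_pow_eq_prod_zmod {K : Type*} [Field K] {p : ℕ} [NeZero p] {ζ : K}
    (hζ : IsPrimitiveRoot ζ p) (x y : K) :
    x ^ p - y ^ p = ∏ m : ZMod p, (x - ζ ^ m.val * y) := by
  rw [hζ.pow_sub_pow_eq_prod_sub_mul x y (NeZero.pos p)]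
  symm
  refine Finset.prod_bij (fun m _ => ζ ^ m.val) (fun m _ => ?_) (fun m _ m' _ h => ?_)
    (fun b hb => ?_) (fun _ _ => rfl)
  · rw [Polynomial.mem_nthRootsFinset (NeZero.pos p), ← pow_mul, mul_comm, pow_mul,
      hζ.pow_eq_one, one_pow]
  · exact ZMod.val_injective p (hζ.pow_inj (ZMod.val_lt _) (ZMod.val_lt _) h)
  · rw [Polynomial.mem_nthRootsFinset (NeZero.pos p)] at hb
    obtain ⟨i, hi, rfl⟩ := hζ.eq_pow_of_pow_eq_one hb
    exact ⟨(i : ZMod p), Finset.mem_univ _, by rw [ZMod.val_cast_of_lt hi]⟩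

/-- Among many distinct roots of a polynomial, many are simple, as multiple roots count twice. -/
theorem two_mul_card_le_natDegree_add_card {K : Type*} [Field K] [DecidableEq K] {P : K[X]}
    (hP : P ≠ 0) (s : Finset K) (hs : ∀ c ∈ s, P.eval c = 0) :
    2 * s.card ≤ P.natDegree + (s.filter fun c => P.derivative.eval c ≠ 0).card := by
  have h1 : ∑ c ∈ s, P.rootMultiplicity c ≤ P.natDegree := by
    refine le_trans ?_ (card_roots' P)
    rw [← Multiset.toFinset_sum_count_eq P.roots]
    simp only [count_roots]
    refine Finset.sum_le_sum_of_subset fun c hc => ?_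
    rw [Multiset.mem_toFinset, mem_roots hP]
    exact hs c hc
  have h2 : ∑ c ∈ s, 2 ≤
      ∑ c ∈ s, (P.rootMultiplicity c + if P.derivative.eval c ≠ 0 then 1 else 0) := by
    refine Finset.sum_le_sum fun c hc => ?_
    have hpos := (rootMultiplicity_pos hP).mpr (hs c hc)
    split_ifs with h
    · omega
    · have := (one_lt_rootMultiplicity_iff_isRoot hP (t := c)).mpr ⟨hs c hc, not_not.mp h⟩
      omega
  rw [Finset.sum_add_distrib, Finset.sum_boole] at h2
  simp only [Finset.sum_const, smul_eq_mul, Nat.cast_id] at h2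
  omega

/-- A polynomial over an algebraically closed valued field whose value at `c` is small compared with
its derivative there has a root close to `c`: `P'/P` at `c` is the sum of the `1 / (c - r)` over the
roots `r`, so one of these is at least as large as the sum. -/
theorem exists_root_valuation_sub_le {K Γ₀ : Type*} [Field K] [IsAlgClosed K]
    [LinearOrderedCommGroupWithZero Γ₀] (v : Valuation K Γ₀) {P : K[X]} {c : K}
    (h : P.derivative.eval c ≠ 0) :
    ∃ r, P.eval r = 0 ∧ v (r - c) ≤ v (P.eval c / P.derivative.eval c) := by
  by_cases h0 : P.eval c = 0
  · exact ⟨c, h0, by simp⟩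
  by_contra! hcon
  have hP : P ≠ 0 := by rintro rfl; simp at h
  have h1 := (IsAlgClosed.splits P).eval_derivative_div_eval_of_ne_zero h0
  have h2 : v ((P.roots.map fun z => 1 / (c - z)).sum) <
      v (P.derivative.eval c / P.eval c) := by
    have h3 : ∀ z ∈ P.roots, v (1 / (c - z)) < v (P.derivative.eval c / P.eval c) := by
      intro z hz
      have := hcon z ((mem_roots hP).mp hz)
      rw [Valuation.map_sub_swap] at this
      rw [← inv_div (P.eval c), one_div, map_inv₀, map_inv₀]
      exact inv_strictAnti₀ (by simp [zero_lt_iff, h, h0]) this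
    generalize P.roots = R at h3
    induction R using Multiset.induction_on with
    | empty => simp [zero_lt_iff, h, h0]
    | cons z R ih =>
      rw [Multiset.map_cons, Multiset.sum_cons]
      exact v.map_add_lt (h3 z (Multiset.mem_cons_self _ _))
        (ih fun w hw => h3 w (Multiset.mem_cons_of_mem hw))
  rw [← h1] at h2
  exact lt_irrefl _ h2

section

variable {I : Type*} [Fintype I] {p n : ℕ} {K : Type*} [Field K]

theorem continuous_kummerValue [DecidableEq I] [NeZero p] [TopologicalSpace K]
    [IsTopologicalRing K] :
    Continuous fun t : (((I → ZMod p) × Fin n → K) × K) × (I → K) =>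
      kummerValue (evalRingHom t.1.2) t.1.1 t.2 := by
  simp only [kummerValue, kummerMonomial, kummerCoeff, coe_evalRingHom, eval_finsetSum, eval_mul,
    eval_C, eval_pow, eval_X]
  fun_prop

/-- The norm depends polynomially on the coefficients `q`, because it is a specialization of the
norm of the generic function; hence its values and those of its derivative are continuous in `q`. -/
theorem continuous_eval_kummerNorm [DecidableEq I] [NeZero p] [TopologicalSpace K]
    [IsTopologicalRing K] (a : I → K) (c : K) :
    Continuous (fun q : (I → ZMod p) × Fin n → K => (kummerNorm a q).eval c) ∧
    Continuous fun q : (I → ZMod p) × Fin n → K => (kummerNorm a q).derivative.eval c := by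
  let R := MvPolynomial ((I → ZMod p) × Fin n) K
  let G : R[X] := kummerNorm (fun i => MvPolynomial.C (a i)) MvPolynomial.X
  have hG : ∀ q : (I → ZMod p) × Fin n → K, kummerNorm a q = G.map (MvPolynomial.eval q) := by
    intro q
    rw [← kummerNorm_map]
    simp
  have key : ∀ (Q : R[X]) (q : (I → ZMod p) × Fin n → K),
      (Q.map (MvPolynomial.eval q)).eval c = MvPolynomial.eval q (Q.eval (MvPolynomial.C c)) := by
    intro Q q
    rw [← eval₂_at_apply, MvPolynomial.eval_C, eval_map]
  simp only [hG, derivative_map, key]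
  exact ⟨MvPolynomial.continuous_eval _, MvPolynomial.continuous_eval _⟩

theorem exists_kummerValue_eq_zero [IsAlgClosed K] [DecidableEq I] [NeZero p] {ζ : K}
    (hζ : IsPrimitiveRoot ζ p) {a : I → K} {q : (I → ZMod p) × Fin n → K} {c : K}
    (hc : ∀ i, c + a i ≠ 0) (h : (kummerNorm a q).eval c = 0) :
    ∃ z : I → K, (∀ i, z i ^ p = c + a i) ∧ kummerValue (evalRingHom c) q z = 0 := by
  choose y hy using fun i => IsAlgClosed.exists_pow_nat_eq (c + a i) (NeZero.pos p)
  have hy0 : ∀ i, y i ≠ 0 := fun i h0 => hc i (by rw [← hy i, h0, zero_pow (NeZero.ne p)])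
  have h1 := map_kummerNorm (evalRingHom c) a q (fun i => by simp [hy]) hy0 hζ
  rw [coe_evalRingHom, h] at h1
  obtain ⟨f, -, hf⟩ := Finset.prod_eq_zero_iff.mp h1.symm
  exact ⟨_, fun i => (rootTwist_pow hζ.pow_eq_one f y i).trans (hy i), hf⟩

variable {Γ₀ : Type*} [LinearOrderedCommGroupWithZero Γ₀] [Valued K Γ₀]

/-- The `p`th roots of elements close to `c + b` are close to the `p`th roots `ζᵐ y` of `c + b`, as
the product of the differences `z - ζᵐ y` is `zᵖ - yᵖ`. -/
theorem eventually_forall_pow_eq_exists_mem {p : ℕ} [NeZero p] {ζ : K} (hζ : IsPrimitiveRoot ζ p)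
    {c y b : K} (hy : y ^ p = c + b) {V : ZMod p → Set K}
    (hV : ∀ m, V m ∈ 𝓝 (ζ ^ m.val * y)) :
    ∀ᶠ c' in 𝓝 c, ∀ z : K, z ^ p = c' + b → ∃ m, z ∈ V m := by
  have hγ := fun m => Valued.mem_nhds.mp (hV m)
  choose γ hγ using hγ
  have hδ := fun m : ZMod p => Finset.inf'_le γ (Finset.mem_univ m)
  set δ := Finset.univ.inf' ⟨0, Finset.mem_univ _⟩ γ
  refine Valued.mem_nhds.mpr ⟨δ ^ p, fun c' hc' z hz => ?_⟩
  by_contra! hcon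
  have h1 : ∀ m : ZMod p, (δ : MonoidWithZeroHom.ValueGroup₀ _) ≤
      Valued.v.restrict (z - ζ ^ m.val * y) := by
    intro m
    by_contra! hlt
    exact hcon m (hγ m (hlt.trans_le (hδ m)))
  have h2 : c' - c = ∏ m : ZMod p, (z - ζ ^ m.val * y) := by
    rw [← hζ.pow_sub_pow_eq_prod_zmod, hz, hy]
    ring
  have h4 : ((δ ^ p : _) : MonoidWithZeroHom.ValueGroup₀ _) ≤ Valued.v.restrict (c' - c) := by
    rw [h2, map_prod, Units.val_pow_eq_pow_val]
    refine le_trans (by simp [ZMod.card]) (Finset.prod_le_prod' fun m _ => h1 m)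
  exact not_lt.mpr h4 hc'

/-- The points of the Kummer curve over elements close to `c` are close to the points over `c`. -/
theorem eventually_forall_pow_eq_exists_mem_pi [DecidableEq I] [NeZero p] {ζ : K}
    (hζ : IsPrimitiveRoot ζ p) {c : K} {a y : I → K} (hy : ∀ i, y i ^ p = c + a i)
    {V : (I → ZMod p) → Set (I → K)} (hV : ∀ f, V f ∈ 𝓝 (rootTwist ζ f y)) :
    ∀ᶠ c' in 𝓝 c, ∀ z : I → K, (∀ i, z i ^ p = c' + a i) → ∃ f, z ∈ V f := by
  have hV' : ∀ f, ∃ B : I → Set K, (∀ i, B i ∈ 𝓝 (rootTwist ζ f y i)) ∧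
      ∀ z : I → K, (∀ i, z i ∈ B i) → z ∈ V f := by
    intro f
    have h := hV f
    rw [nhds_pi, mem_pi'] at h
    obtain ⟨J, B, hB, hJ⟩ := h
    exact ⟨B, hB, fun z hz => hJ fun i _ => hz i⟩
  choose B hB hBV using hV'
  have h1 : ∀ i, ∀ᶠ c' in 𝓝 c, ∀ z : K, z ^ p = c' + a i →
      ∃ m, z ∈ ⋂ f : I → ZMod p, ⋂ _ : f i = m, B f i := by
    intro i
    refine eventually_forall_pow_eq_exists_mem hζ (hy i) fun m => ?_
    refine (iInter_mem).mpr fun f => (iInter_mem).mpr fun hf => ?_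
    rw [← hf]
    exact hB f i
  filter_upwards [eventually_all.mpr h1] with c' hc' z hz
  choose f hf using fun i => hc' i (z i) (hz i)
  refine ⟨f, hBV f z fun i => ?_⟩
  have := hf i
  simp only [Set.mem_iInter] at this
  exact this f rfl

/-- If the norm of a function `A` has a simple root at `c`, coming from the zero `y` over `c`, then
the norm of each function close to `A` has a root close to `c` over which all zeros are close to
`y`. Simplicity of the root means that `y` is the only zero of `A` over `c`, so that functions close
to `A` do not vanish near the other points over `c`. -/
theorem eventually_exists_root_kummerNorm [IsAlgClosed K] [DecidableEq I] [NeZero p] {ζ : K}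
    (hζ : IsPrimitiveRoot ζ p) {a : I → K} {A : (I → ZMod p) × Fin n → K} {c : K}
    (hc : (kummerNorm a A).derivative.eval c ≠ 0) {y : I → K} (hy : ∀ i, y i ^ p = c + a i)
    (hy0 : ∀ i, y i ≠ 0) (hA : kummerValue (evalRingHom c) A y = 0)
    {Y : Set (I → K)} (hY : Y ∈ 𝓝 y) {N : Set K} (hN : N ∈ 𝓝 c) :
    ∀ᶠ h in 𝓝 A, ∃ c' ∈ N, (kummerNorm a h).eval c' = 0 ∧
      ∀ z : I → K, (∀ i, z i ^ p = c' + a i) → kummerValue (evalRingHom c') h z = 0 → z ∈ Y := by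
  -- a second zero over `c` would make `c` a double root of the norm
  have hbranch : ∀ f : I → ZMod p, f ≠ 0 →
      kummerValue (evalRingHom c) A (rootTwist ζ f y) ≠ 0 := by
    intro f hf h0
    have hd := pow_card_dvd_kummerNorm a A c hy hy0 hζ {0, f} (by
      intro g hg
      rw [Finset.mem_insert, Finset.mem_singleton] at hg
      rcases hg with rfl | rfl
      · rwa [rootTwist_zero]
      · exact h0)
    rw [Finset.card_pair hf.symm] at hd
    obtain ⟨Q, hQ⟩ := hd
    apply hc
    rw [hQ]
    simp [derivative_mul, derivative_pow]
  -- near each point over `c`, a zero of a function close to `A` lies in `Y`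
  have hloc : ∀ f : I → ZMod p, ∀ᶠ t in 𝓝 ((A, c), rootTwist ζ f y),
      kummerValue (evalRingHom t.1.2) t.1.1 t.2 = 0 → t.2 ∈ Y := by
    intro f
    by_cases hf : f = 0
    · subst hf
      rw [rootTwist_zero]
      filter_upwards [continuous_snd.continuousAt.preimage_mem_nhds (x := ((A, c), y)) hY]
        with t ht _ using ht
    · filter_upwards [(continuous_kummerValue (p := p) (n := n)).continuousAt.eventually_ne
        (x := ((A, c), rootTwist ζ f y)) (hbranch f hf)] with t ht h0 using absurd h0 ht
  have hbox : ∀ f : I → ZMod p, ∃ U ∈ 𝓝 A, ∃ N' ∈ 𝓝 c, ∃ V ∈ 𝓝 (rootTwist ζ f y),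
      ∀ h ∈ U, ∀ c' ∈ N', ∀ z ∈ V, kummerValue (evalRingHom c') h z = 0 → z ∈ Y := by
    intro f
    have h := hloc f
    rw [nhds_prod_eq, eventually_iff, mem_prod_iff] at h
    obtain ⟨W, hW, V, hV, hWV⟩ := h
    rw [nhds_prod_eq, mem_prod_iff] at hW
    obtain ⟨U, hU, N', hN', hUN⟩ := hW
    exact ⟨U, hU, N', hN', V, hV, fun h hh c' hc' z hz =>
      @hWV ((h, c'), z) ⟨@hUN (h, c') ⟨hh, hc'⟩, hz⟩⟩
  choose U hU N' hN' V hV hUV using hbox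
  have hnear : {r | ∀ z : I → K, (∀ i, z i ^ p = r + a i) → ∃ f, z ∈ V f} ∩
      (⋂ f, N' f) ∩ N ∈ 𝓝 c :=
    inter_mem (inter_mem (eventually_forall_pow_eq_exists_mem_pi hζ hy hV)
      (iInter_mem.mpr hN')) hN
  obtain ⟨γ, hγ⟩ := Valued.mem_nhds.mp hnear
  have hA0 := eval_kummerNorm_eq_zero hy hy0 hζ hA
  obtain ⟨hc1, hc2⟩ := continuous_eval_kummerNorm (n := n) (p := p) a c
  have hlim : Tendsto (fun h => (kummerNorm a h).eval c / (kummerNorm a h).derivative.eval c)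
      (𝓝 A) (𝓝 0) := by
    have := (hc1.tendsto A).div (hc2.tendsto A) hc
    rwa [hA0, zero_div] at this
  have hsmall : {x : K | Valued.v.restrict x < γ.1} ∈ 𝓝 (0 : K) :=
    Valued.mem_nhds_zero.mpr ⟨γ, subset_rfl⟩
  filter_upwards [hlim hsmall, hc2.continuousAt.eventually_ne hc, iInter_mem.mpr hU]
    with h h1 h2 h3
  obtain ⟨r, hr, hrc⟩ := exists_root_valuation_sub_le Valued.v.restrict h2
  obtain ⟨⟨hr1, hr2⟩, hr3⟩ := hγ (hrc.trans_lt h1)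
  refine ⟨r, hr3, hr, fun z hz hz0 => ?_⟩
  obtain ⟨f, hf⟩ := hr1 z hz
  exact hUV f h (Set.mem_iInter.mp h3 f) r (Set.mem_iInter.mp hr2 f) z hf hz0

/-- Let the open set `Y` contain points over infinitely many elements. Then there is a function `A`
such that, for each function close to `A`, the norm has more than half as many roots as the bound on
its degree, all unramified, over which every zero of the function lies in `Y`.

With `d = p ^ #I` there are `d * n` coefficients, so `A ≠ 0` may be prescribed to vanish at
`d * n - 1` points of `Y`. This is close enough to the bound `d * (n - 1 + #I)` on the degree of the
norm that most of these zeros give simple roots, which persist near `A`. The hypothesis on `n` makes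
these numbers leave a strict majority. -/
theorem exists_eventually_majority_roots [IsAlgClosed K] [DecidableEq I] [NeZero p] {ζ : K}
    (hζ : IsPrimitiveRoot ζ p) {a : I → K} (ha : Function.Injective a) {Y : Set (I → K)}
    (hYo : IsOpen Y)
    (hn : n = 3 * Fintype.card I + 2)
    (hY : {c : K | ∃ y ∈ Y, ∀ i, y i ^ p = c + a i ∧ y i ≠ 0}.Infinite) :
    ∃ A : (I → ZMod p) × Fin n → K, ∀ᶠ h in 𝓝 A, kummerNorm a h ≠ 0 ∧
      ∃ s : Finset K, p ^ Fintype.card I * (n - 1 + Fintype.card I) < 2 * s.card ∧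
        ∀ c ∈ s, (kummerNorm a h).eval c = 0 ∧ (∀ i, c + a i ≠ 0) ∧
          ∀ z : I → K, (∀ i, z i ^ p = c + a i) → kummerValue (evalRingHom c) h z = 0 → z ∈ Y := by
  classical
  set d := p ^ Fintype.card I with hd
  have hd0 : 0 < d := pow_pos (NeZero.pos p) _
  obtain ⟨s, hs, hcard⟩ := hY.exists_subset_card_eq (d * n - 1)
  have hs' : ∀ c ∈ s, ∃ y ∈ Y, ∀ i, y i ^ p = c + a i ∧ y i ≠ 0 := fun c hc => hs hc
  choose! y hyY hy using hs'
  -- there is one linear condition less than there are coefficients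
  obtain ⟨A, hA0, hA⟩ : ∃ A : (I → ZMod p) × Fin n → K, A ≠ 0 ∧
      ∀ c ∈ s, kummerValue (evalRingHom c) A (y c) = 0 := by
    let ev : ((I → ZMod p) × Fin n → K) →ₗ[K] (s → K) :=
      { toFun := fun q c => kummerValue (evalRingHom (c : K)) q (y c)
        map_add' := by
          intro q q'
          ext c
          simp [kummerValue, kummerCoeff, add_mul, Finset.sum_add_distrib, eval_finsetSum]
        map_smul' := by
          intro r q
          ext c
          simp [kummerValue, kummerCoeff, Finset.mul_sum, mul_assoc, Finset.sum_mul] }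
    have hker : LinearMap.ker ev ≠ ⊥ := by
      apply LinearMap.ker_ne_bot_of_finrank_lt
      simp only [Module.finrank_fintype_fun_eq_card, Fintype.card_coe, hcard, Fintype.card_prod,
        Fintype.card_fun, ZMod.card, Fintype.card_fin, ← hd]
      have : 0 < d * n := Nat.mul_pos hd0 (by omega)
      omega
    obtain ⟨A, hA, hA0⟩ := Submodule.exists_mem_ne_zero_of_ne_bot hker
    exact ⟨A, hA0, fun c hc => congrFun hA ⟨c, hc⟩⟩
  refine ⟨A, ?_⟩
  have hroot : ∀ c ∈ s, (kummerNorm a A).eval c = 0 := fun c hc =>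
    eval_kummerNorm_eq_zero (fun i => (hy c hc i).1) (fun i => (hy c hc i).2) hζ (hA c hc)
  set G := s.filter fun c => (kummerNorm a A).derivative.eval c ≠ 0 with hG
  have hcount := two_mul_card_le_natDegree_add_card (kummerNorm_ne_zero hζ ha hA0) s hroot
  have hdeg := natDegree_kummerNorm_le a A
  rw [← hG, hcard] at hcount
  obtain ⟨N, hN, hdisj⟩ := G.finite_toSet.t2_separation
  have hev : ∀ᶠ h in 𝓝 A, ∀ c ∈ G, ∃ c' ∈ N c ∩ {x | ∀ i, x + a i ≠ 0},
      (kummerNorm a h).eval c' = 0 ∧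
      ∀ z : I → K, (∀ i, z i ^ p = c' + a i) →
        kummerValue (evalRingHom c') h z = 0 → z ∈ Y := by
    rw [eventually_all_finset]
    intro c hc
    obtain ⟨hcs, hc0⟩ := Finset.mem_filter.mp hc
    exact eventually_exists_root_kummerNorm hζ hc0 (fun i => (hy c hcs i).1)
      (fun i => (hy c hcs i).2) (hA c hcs) (hYo.mem_nhds (hyY c hcs))
      (inter_mem ((hN c).2.mem_nhds (hN c).1) (eventually_all.mpr fun i =>
        (continuous_id.add continuous_const).continuousAt.eventually_ne (by
          change c + a i ≠ 0
          rw [← (hy c hcs i).1]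
          exact pow_ne_zero p (hy c hcs i).2)))
  filter_upwards [hev, eventually_ne_nhds hA0] with h hh h0
  refine ⟨kummerNorm_ne_zero hζ ha h0, ?_⟩
  choose! r hrN hr0 hr using hh
  refine ⟨G.image r, ?_, ?_⟩
  · rw [Finset.card_image_of_injOn]
    · have h1 : n - 1 + Fintype.card I = 4 * Fintype.card I + 1 := by omega
      have h2 : d * n = 3 * (d * Fintype.card I) + 2 * d := by rw [hn]; ring
      have h3 : d * (4 * Fintype.card I + 1) = 4 * (d * Fintype.card I) + d := by ring
      rw [← hd, h1, h3] at hdeg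
      rw [h1, h3]
      omega
    · intro c hc c' hc' hcc
      by_contra hne
      exact Set.disjoint_left.mp (hdisj hc hc' hne) (hrN c hc).1 (by
        change r c = r c' at hcc
        rw [hcc]
        exact (hrN c' hc').1)
  · intro c' hc'
    obtain ⟨c, hc, rfl⟩ := Finset.mem_image.mp hc'
    exact ⟨hr0 c hc, (hrN c hc).2, hr c hc⟩

end

end KummerCurve

namespace MultiValued

section Valuations

open Polynomial Topology Filter

/-! ### Independent valuation rings and weak approximation -/

variable {K : Type*} [Field K]

theorem mem_nhds_valTopology (O : ValuationSubring K) {s : Set K} {x : K} :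
    s ∈ @nhds K (valTopology O) x ↔
      ∃ c : K, c ≠ 0 ∧ {y | O.valuation (y - x) < O.valuation c} ⊆ s := by
  let := Valued.mk' O.valuation
  have h : s ∈ @nhds K (valTopology O) x ↔ s ∈ 𝓝 x := Iff.rfl
  rw [h, Valued.mem_nhds]
  constructor
  · rintro ⟨γ, hγ⟩
    obtain ⟨c, hc⟩ := O.valuation_surjective (MonoidWithZeroHom.ValueGroup₀.embedding γ.1)
    refine ⟨c, ?_, fun y hy => hγ ?_⟩
    · rintro rfl
      rw [map_zero] at hc
      exact (_root_.map_ne_zero _).mpr γ.ne_zero hc.symm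
    · rw [Set.mem_ofPred_eq, Valuation.restrict_lt_iff_lt_embedding]
      exact lt_of_lt_of_eq hy hc
  · rintro ⟨c, hc, hs⟩
    refine ⟨Units.mk0 (Valued.v.restrict c) (by simpa using hc), fun y hy => hs ?_⟩
    rw [Set.mem_ofPred_eq, Units.val_mk0, Valuation.restrict_lt_iff] at hy
    exact hy

/-- If `O₁ * O₂` misses `d`, then every ball of `O₁` contains one of `O₂`, smaller by a factor `d`.
-/
theorem valTopology_le_of_notMem_mul {O₁ O₂ : ValuationSubring K} {d : K}
    (hd : ∀ a ∈ O₁, ∀ b ∈ O₂, a * b ≠ d) : valTopology O₂ ≤ valTopology O₁ := by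
  have hd0 : d ≠ 0 := fun h => hd 0 O₁.zero_mem 0 O₂.zero_mem (by rw [h, mul_zero])
  rw [le_iff_nhds]
  intro x s hs
  rw [mem_nhds_valTopology] at hs ⊢
  obtain ⟨c, hc, hs⟩ := hs
  refine ⟨c * d⁻¹, mul_ne_zero hc (inv_ne_zero hd0), fun y hy => hs ?_⟩
  rw [Set.mem_ofPred_eq] at hy ⊢
  obtain ⟨b, hb⟩ : ∃ b, y - x = c * d⁻¹ * b := ⟨(c * d⁻¹)⁻¹ * (y - x), by field_simp⟩
  rw [hb, map_mul] at hy ⊢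
  have hb1 : O₂.valuation b < 1 :=
    (mul_lt_iff_lt_one_right (zero_lt_iff.mpr (by simp [hc, hd0]))).mp hy
  rw [← map_mul, mul_assoc, map_mul]
  refine mul_lt_of_lt_one_right (zero_lt_iff.mpr (by simp [hc])) (not_le.mp fun h => ?_)
  have hb0 : b ≠ 0 := by
    rintro rfl
    simp at h
  refine hd (d * b⁻¹) ?_ b ((O₂.valuation_le_one_iff b).mp hb1.le) (by field_simp)
  rw [← O₁.valuation_le_one_iff]
  have h2 : d * b⁻¹ = (d⁻¹ * b)⁻¹ := by field_simp
  rw [h2, map_inv₀]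
  exact inv_le_one_of_one_le₀ h

/-- Independent valuation rings have no common coarsening other than `K`. -/
theorem Independent.exists_mul_eq {O₁ O₂ : ValuationSubring K} (h : Independent O₁ O₂) (d : K) :
    ∃ a ∈ O₁, ∃ b ∈ O₂, a * b = d := by
  by_contra! hd
  exact h (le_antisymm
    (valTopology_le_of_notMem_mul fun b hb a ha => by rw [mul_comm]; exact hd a ha b hb)
    (valTopology_le_of_notMem_mul hd))

theorem exists_valuation_lt_one {O : ValuationSubring K} (h : O ≠ ⊤) :
    ∃ c : K, c ≠ 0 ∧ O.valuation c < 1 := by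
  by_contra! hc
  apply h
  rw [eq_top_iff]
  intro x _
  by_cases hx : x = 0
  · rw [hx]; exact O.zero_mem
  · rw [← O.valuation_le_one_iff]
    have := hc x⁻¹ (inv_ne_zero hx)
    rw [map_inv₀] at this
    exact (one_le_inv₀ (zero_lt_iff.mpr (by simp [hx]))).mp this

theorem exists_small {O : ValuationSubring K} (h : O ≠ ⊤) {α c : K} (hα : α ≠ 0) (hc : c ≠ 0) :
    ∃ ε : K, ε ≠ 0 ∧ O.valuation ε < 1 ∧ O.valuation (α * ε) < O.valuation c := by
  obtain ⟨π, hπ0, hπ⟩ := exists_valuation_lt_one h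
  have h2 : O.valuation (α * (π * (c / α))) < O.valuation c := by
    rw [show α * (π * (c / α)) = π * c by field_simp, map_mul]
    exact mul_lt_of_lt_one_left (zero_lt_iff.mpr (by simp [hc])) hπ
  rcases le_total (O.valuation π) (O.valuation (π * (c / α))) with h1 | h1
  · refine ⟨π, hπ0, hπ, lt_of_le_of_lt ?_ h2⟩
    rw [map_mul, map_mul _ α]
    gcongr
  · exact ⟨π * (c / α), by simp [hπ0, hc, hα], h1.trans_lt hπ, h2⟩

theorem valuation_one_add_eq_one {O : ValuationSubring K} {z : K} (hz : O.valuation z < 1) :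
    O.valuation (1 + z) = 1 := by
  rw [Valuation.map_add_eq_of_lt_left _ (by rwa [map_one]), map_one]

/-- Weak approximation for two independent valuations. -/
theorem Independent.exists_approx {O₁ O₂ : ValuationSubring K} (h : Independent O₁ O₂)
    (h₁ : O₁ ≠ ⊤) (h₂ : O₂ ≠ ⊤) (α β : K) {c₁ c₂ : K} (hc₁ : c₁ ≠ 0) (hc₂ : c₂ ≠ 0) :
    ∃ x, O₁.valuation (x - α) < O₁.valuation c₁ ∧ O₂.valuation (x - β) < O₂.valuation c₂ := by
  by_cases hαβ : β - α = 0
  · refine ⟨α, ?_, ?_⟩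
    · rw [sub_self, map_zero, zero_lt_iff]; simpa
    · rw [(sub_eq_zero.mp hαβ), sub_self, map_zero, zero_lt_iff]; simpa
  obtain ⟨ε₁, hε₁, hε₁1, hε₁c⟩ := exists_small h₁ hαβ hc₁
  obtain ⟨ε₂, hε₂, hε₂1, hε₂c⟩ := exists_small h₂ hαβ hc₂
  obtain ⟨a, ha, b, hb, hab⟩ := h.exists_mul_eq (ε₁ * ε₂)⁻¹
  have hab0 : a * b ≠ 0 := by rw [hab]; exact inv_ne_zero (mul_ne_zero hε₁ hε₂)
  have ha0 := left_ne_zero_of_mul hab0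
  have hb0 := right_ne_zero_of_mul hab0
  -- `z` is small for the first valuation, and its inverse is small for the second
  obtain ⟨z, hz⟩ : ∃ z, z = ε₁ * a := ⟨_, rfl⟩
  have hz0 : z ≠ 0 := hz ▸ mul_ne_zero hε₁ ha0
  have hzi : z⁻¹ = ε₂ * b := by
    rw [hz]
    field_simp at hab ⊢
    linear_combination -hab
  have hle₁ : O₁.valuation z ≤ O₁.valuation ε₁ := by
    rw [hz, map_mul]
    exact mul_le_of_le_one_right' ((O₁.valuation_le_one_iff a).mpr ha)
  have hle₂ : O₂.valuation z⁻¹ ≤ O₂.valuation ε₂ := by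
    rw [hzi, map_mul]
    exact mul_le_of_le_one_right' ((O₂.valuation_le_one_iff b).mpr hb)
  have hu₁ := valuation_one_add_eq_one (hle₁.trans_lt hε₁1)
  have hu₂ := valuation_one_add_eq_one (hle₂.trans_lt hε₂1)
  have hz1 : 1 + z ≠ 0 := by
    intro h0
    rw [h0, map_zero] at hu₁
    exact zero_ne_one hu₁
  have hzi1 : 1 + z⁻¹ ≠ 0 := by
    intro h0
    rw [h0, map_zero] at hu₂
    exact zero_ne_one hu₂
  refine ⟨α + (β - α) * (z / (1 + z)), ?_, ?_⟩
  · rw [add_sub_cancel_left, map_mul, map_div₀, hu₁, div_one]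
    refine lt_of_le_of_lt ?_ hε₁c
    rw [map_mul]
    gcongr
  · have : α + (β - α) * (z / (1 + z)) - β = -((β - α) * (z⁻¹ / (1 + z⁻¹))) := by
      have : z + 1 ≠ 0 := by rwa [add_comm]
      field_simp
      ring
    rw [this, Valuation.map_neg, map_mul, map_div₀, hu₂, div_one]
    refine lt_of_le_of_lt ?_ hε₂c
    rw [map_mul]
    gcongr

/-! ### Points on the Kummer curve with prescribed residues -/

theorem mem_onePlusMaximalIdeal {O : ValuationSubring K} {u : K} :
    u ∈ onePlusMaximalIdeal O ↔ O.valuation (u - 1) < 1 := by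
  constructor
  · rintro ⟨a, ha, rfl⟩
    rw [add_sub_cancel_left]
    exact (O.valuation_lt_one_iff a).mp ha
  · intro h
    exact ⟨⟨u - 1, (O.valuation_le_one_iff _).mp h.le⟩, (O.valuation_lt_one_iff _).mpr h,
      (add_sub_cancel _ _).symm⟩

theorem valuation_natCast_eq_one {O : ValuationSubring K} {p : ℕ} (hp : p.Prime)
    (h : p ≠ ringChar (IsLocalRing.ResidueField O)) : O.valuation (p : K) = 1 := by
  have h1 : ((p : O) : K) = (p : K) := by simp
  rw [← h1]
  refine (O.valuation_lt_one_or_eq_one (p : O)).resolve_left fun hlt => ?_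
  rw [← O.valuation_lt_one_iff, ← IsLocalRing.residue_eq_zero_iff, map_natCast,
    ringChar.spec, Nat.dvd_prime hp] at hlt
  rcases hlt with h2 | h2
  · exact CharP.ringChar_ne_one h2
  · exact h h2.symm

/-- The only `p`th root of unity in `1 + 𝔪` is `1`, if `p` is not the residue characteristic: any
other one would make `p` congruent to `∑ ωⁱ = 0` modulo `𝔪`. -/
theorem eq_one_of_pow_eq_one {O : ValuationSubring K} {p : ℕ} (hp : O.valuation (p : K) = 1)
    {ω : K} (hω : ω ^ p = 1) (h : O.valuation (ω - 1) < 1) : ω = 1 := by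
  by_contra hne
  have h0 : ∑ i ∈ Finset.range p, ω ^ i = 0 := by rw [geom_sum_eq hne, hω]; simp
  have hu : O.valuation ω = 1 := by
    have := valuation_one_add_eq_one h
    rwa [add_sub_cancel] at this
  have h1 : (p : K) = -∑ i ∈ Finset.range p, (ω ^ i - 1) := by
    rw [Finset.sum_sub_distrib, h0]
    simp
  have h2 : O.valuation (p : K) < 1 := by
    rw [h1, Valuation.map_neg]
    refine Valuation.map_sum_lt _ one_ne_zero fun i _ => ?_
    rw [← mul_geom_sum ω i, map_mul]
    refine mul_lt_one_of_lt_of_le h ?_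
    refine Valuation.map_sum_le _ fun j _ => ?_
    rw [map_pow, hu, one_pow]
  exact h2.ne hp

theorem injective_pow_succ {O : ValuationSubring K} {π : K} (hπ0 : π ≠ 0)
    (hπ : O.valuation π < 1) : Function.Injective fun j : ℕ => π ^ (j + 1) := by
  have h1 : StrictAnti fun j : ℕ => O.valuation π ^ (j + 1) := by
    refine strictAnti_nat_of_succ_lt fun j => ?_
    rw [pow_succ _ (j + 1)]
    exact mul_lt_of_lt_one_right (pow_pos (zero_lt_iff.mpr (by simp [hπ0])) _) hπ
  intro j j' h
  apply h1.injective
  simp only [← map_pow, h]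

/-- For `aᵢ ∈ 𝔪` and `p`th roots of unity `ηᵢ`, infinitely many `c` have a point over them on the
Kummer curve all of whose coordinates `yᵢ` are nonzero and congruent to `ηᵢ`: every `c ∈ 1 + 𝔪` is
one. -/
theorem infinite_points [IsAlgClosed K] {I : Type*} {O : ValuationSubring K} (hO : O ≠ ⊤)
    {p : ℕ} [NeZero p]
    {ζ : K} (hζ : IsPrimitiveRoot ζ p) {a η : I → K} (ha : ∀ i, O.valuation (a i) < 1)
    (hη : ∀ i, η i ^ p = 1) :
    {c : K | ∃ y ∈ {y : I → K | ∀ i, O.valuation (y i - η i) < 1},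
      ∀ i, y i ^ p = c + a i ∧ y i ≠ 0}.Infinite := by
  obtain ⟨π, hπ0, hπ⟩ := exists_valuation_lt_one hO
  have hinj : Function.Injective fun j : ℕ => 1 + π ^ (j + 1) :=
    (add_right_injective 1).comp (injective_pow_succ hπ0 hπ)
  refine Set.infinite_of_injective_forall_mem hinj fun j => ?_
  have hζ1 : O.valuation ζ = 1 := by
    have h1 : O.valuation ζ ^ p = 1 := by rw [← map_pow, hζ.pow_eq_one, map_one]
    rcases lt_trichotomy (O.valuation ζ) 1 with h2 | h2 | h2
    · exact absurd h1 (pow_lt_one₀ zero_le h2 (NeZero.ne p)).ne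
    · exact h2
    · exact absurd h1 (one_lt_pow₀ h2 (NeZero.ne p)).ne'
  have hπj : O.valuation (π ^ (j + 1)) < 1 := by
    rw [map_pow]
    exact pow_lt_one₀ zero_le hπ (Nat.succ_ne_zero j)
  have hi : ∀ i, ∃ z : K, O.valuation (z - η i) < 1 ∧ z ^ p = 1 + π ^ (j + 1) + a i ∧ z ≠ 0 := by
    intro i
    have hlt : O.valuation (π ^ (j + 1) + a i) < 1 := Valuation.map_add_lt _ hπj (ha i)
    obtain ⟨y, hy⟩ := IsAlgClosed.exists_pow_nat_eq (1 + π ^ (j + 1) + a i) (NeZero.pos p)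
    have hprod : O.valuation (∏ m : ZMod p, (y - ζ ^ m.val * η i)) < 1 := by
      rwa [← hζ.pow_sub_pow_eq_prod_zmod, hy, hη, add_assoc, add_sub_cancel_left]
    obtain ⟨m, hm⟩ : ∃ m : ZMod p, O.valuation (y - ζ ^ m.val * η i) < 1 := by
      by_contra! hcon
      rw [map_prod] at hprod
      exact not_le.mpr hprod (Finset.one_le_prod' fun m _ => hcon m)
    have hζm : ζ ^ m.val ≠ 0 := pow_ne_zero _ (hζ.ne_zero (NeZero.ne p))
    have hzp : ((ζ ^ m.val)⁻¹ * y) ^ p = 1 + π ^ (j + 1) + a i := by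
      rw [mul_pow, inv_pow, ← pow_mul, mul_comm m.val, pow_mul, hζ.pow_eq_one, one_pow, inv_one,
        one_mul, hy]
    refine ⟨(ζ ^ m.val)⁻¹ * y, ?_, hzp, ?_⟩
    · have : (ζ ^ m.val)⁻¹ * y - η i = (ζ ^ m.val)⁻¹ * (y - ζ ^ m.val * η i) := by
        field_simp
      rwa [this, map_mul, map_inv₀, map_pow, hζ1, one_pow, inv_one, one_mul]
    · intro h0
      rw [h0, zero_pow (NeZero.ne p), add_assoc] at hzp
      have := valuation_one_add_eq_one hlt
      rw [← hzp, map_zero] at this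
      exact zero_ne_one this
  choose z hz1 hz2 hz3 using hi
  exact ⟨z, hz1, fun i => ⟨hz2 i, hz3 i⟩⟩

/-- `exists_eventually_majority_roots` for the topology of a valuation ring and the open set of the
points congruent to `η`, with the neighbourhood of `A` made explicit. -/
theorem exists_coeff_majority_roots [IsAlgClosed K] {k n p : ℕ} [NeZero p]
    {O : ValuationSubring K} (hO : O ≠ ⊤) {ζ : K} (hζ : IsPrimitiveRoot ζ p)
    {a η : Fin k → K} (hinj : Function.Injective a) (ha : ∀ i, O.valuation (a i) < 1)
    (hη : ∀ i, η i ^ p = 1) (hn : n = 3 * k + 2) :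
    ∃ (A : (Fin k → ZMod p) × Fin n → K) (ε : K), ε ≠ 0 ∧
      ∀ h : (Fin k → ZMod p) × Fin n → K, (∀ t, O.valuation (h t - A t) < O.valuation ε) →
        kummerNorm a h ≠ 0 ∧
        ∃ s : Finset K, p ^ k * (n - 1 + k) < 2 * s.card ∧
          ∀ c ∈ s, (kummerNorm a h).eval c = 0 ∧ (∀ i, c + a i ≠ 0) ∧
            ∀ z : Fin k → K, (∀ i, z i ^ p = c + a i) → kummerValue (evalRingHom c) h z = 0 →
              ∀ i, O.valuation (z i - η i) < 1 := by
  let := Valued.mk' O.valuation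
  have hopen : IsOpen {y : Fin k → K | ∀ i, O.valuation (y i - η i) < 1} := by
    rw [Set.ofPred_forall]
    refine isOpen_iInter_of_finite fun i => ?_
    have h1 : IsOpen {x : K | Valued.v.restrict x < 1} := Valued.isOpen_ball K 1
    have h2 : Continuous fun y : Fin k → K => y i - η i := by fun_prop
    have h3 := h1.preimage h2
    simp only [Valuation.restrict_lt_one_iff] at h3
    exact h3
  obtain ⟨A, hA⟩ := exists_eventually_majority_roots (n := n) hζ hinj hopen
    (by rw [hn, Fintype.card_fin]) (infinite_points hO hζ ha hη)
  rw [Fintype.card_fin, eventually_iff, nhds_pi, mem_pi'] at hA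
  obtain ⟨J, B, hB, hJ⟩ := hA
  have hB' := fun t => (mem_nhds_valTopology O).mp (hB t)
  choose δ hδ0 hδ using hB'
  obtain ⟨ε, hε0, hε⟩ : ∃ ε : K, ε ≠ 0 ∧ ∀ t, O.valuation ε ≤ O.valuation (δ t) := by
    by_cases hne : Nonempty ((Fin k → ZMod p) × Fin n)
    · obtain ⟨t, ht⟩ := Finite.exists_min fun t => O.valuation (δ t)
      exact ⟨δ t, hδ0 t, ht⟩
    · exact ⟨1, one_ne_zero, fun t => absurd ⟨t⟩ hne⟩
  exact ⟨A, ε, hε0, fun h hh => hJ fun t _ => hδ t ((hh t).trans_le (hε t))⟩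

/-- The family of sets `W - b` shatters finite sets of every size. For `S ⊆ {1, …, k}`, a point of
the Kummer curve is found that is congruent to `(1, …, 1)` for the first valuation and, for the
second, to the tuple with entries `1` at `i ∈ S` and `ζ` at `i ∉ S`. -/
theorem exists_shattered_pthPowers [IsAlgClosed K] {O₁ O₂ : ValuationSubring K} (h₁ : O₁ ≠ ⊤)
    (h₂ : O₂ ≠ ⊤) (hind : Independent O₁ O₂) {p : ℕ} (hp : p.Prime)
    (hp₁ : p ≠ ringChar (IsLocalRing.ResidueField O₁))
    (hp₂ : p ≠ ringChar (IsLocalRing.ResidueField O₂)) (k : ℕ) :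
    ∃ (a : Fin k → K) (b : Set (Fin k) → K),
      ∀ S i, a i + b S ∈ pthPowers O₁ O₂ p ↔ i ∈ S := by
  classical
  have hv₁ := valuation_natCast_eq_one hp hp₁
  have hv₂ := valuation_natCast_eq_one hp hp₂
  have : NeZero p := ⟨hp.ne_zero⟩
  have : NeZero (p : K) := ⟨by
    intro h0
    rw [h0, map_zero] at hv₁
    exact zero_ne_one hv₁⟩
  obtain ⟨ζ, hζ⟩ := HasEnoughRootsOfUnity.exists_primitiveRoot K p
  obtain ⟨π, hπ0, hπ₁, hπ₂⟩ : ∃ π : K, π ≠ 0 ∧ O₁.valuation π < 1 ∧ O₂.valuation π < 1 := by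
    obtain ⟨π₁, hπ₁0, hπ₁⟩ := exists_valuation_lt_one h₁
    obtain ⟨π₂, hπ₂0, hπ₂⟩ := exists_valuation_lt_one h₂
    obtain ⟨x, hx₁, hx₂⟩ := hind.exists_approx h₁ h₂ π₁ π₂ hπ₁0 hπ₂0
    have hx₁' := Valuation.map_eq_of_sub_lt _ hx₁
    have hx₂' := Valuation.map_eq_of_sub_lt _ hx₂
    refine ⟨x, ?_, hx₁' ▸ hπ₁, hx₂' ▸ hπ₂⟩
    rintro rfl
    rw [map_zero] at hx₁'
    exact (_root_.map_ne_zero _).mpr hπ₁0 hx₁'.symm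
  let a : Fin k → K := fun i => π ^ ((i : ℕ) + 1)
  have ha₁ : ∀ i, O₁.valuation (a i) < 1 := fun i => by
    rw [map_pow]
    exact pow_lt_one₀ zero_le hπ₁ (Nat.succ_ne_zero _)
  have ha₂ : ∀ i, O₂.valuation (a i) < 1 := fun i => by
    rw [map_pow]
    exact pow_lt_one₀ zero_le hπ₂ (Nat.succ_ne_zero _)
  have hinj : Function.Injective a := (injective_pow_succ hπ0 hπ₁).comp Fin.val_injective
  refine ⟨a, ?_⟩
  suffices H : ∀ S : Set (Fin k), ∃ b : K, ∀ i, a i + b ∈ pthPowers O₁ O₂ p ↔ i ∈ S by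
    choose b hb using H
    exact ⟨b, hb⟩
  intro S
  let η : Fin k → K := fun i => if i ∈ S then 1 else ζ
  have hη : ∀ i, η i ^ p = 1 := fun i => by
    simp only [η]
    split_ifs
    · exact one_pow p
    · exact hζ.pow_eq_one
  obtain ⟨A₁, ε₁, hε₁, hA₁⟩ := exists_coeff_majority_roots (η := fun _ => 1) h₁ hζ hinj ha₁
    (fun _ => one_pow p) rfl
  obtain ⟨A₂, ε₂, hε₂, hA₂⟩ := exists_coeff_majority_roots h₂ hζ hinj ha₂ hη rfl
  choose h hh₁ hh₂ using fun t => hind.exists_approx h₁ h₂ (A₁ t) (A₂ t) hε₁ hε₂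
  obtain ⟨hF, s₁, hs₁, hr₁⟩ := hA₁ h hh₁
  obtain ⟨-, s₂, hs₂, hr₂⟩ := hA₂ h hh₂
  -- two majorities of the roots of the norm meet
  obtain ⟨c, hc⟩ : (s₁ ∩ s₂).Nonempty := by
    have hsub : ∀ s : Finset K, (∀ c ∈ s, (kummerNorm a h).eval c = 0) →
        s ⊆ (kummerNorm a h).roots.toFinset := fun s hs c hc => by
      rw [Multiset.mem_toFinset, mem_roots hF]
      exact hs c hc
    have hcard := (Multiset.toFinset_card_le _).trans
      ((card_roots' (kummerNorm a h)).trans (natDegree_kummerNorm_le a h))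
    rw [Fintype.card_fin] at hcard
    refine Finset.inter_nonempty_of_card_lt_card_add_card (hsub s₁ fun c hc => (hr₁ c hc).1)
      (hsub s₂ fun c hc => (hr₂ c hc).1) ?_
    omega
  obtain ⟨hc₁, hc₂⟩ := Finset.mem_inter.mp hc
  obtain ⟨z, hz, hz0⟩ := exists_kummerValue_eq_zero hζ (hr₁ c hc₁).2.1 (hr₁ c hc₁).1
  have hz₁ := (hr₁ c hc₁).2.2 z hz hz0
  have hz₂ := (hr₂ c hc₂).2.2 z hz hz0
  refine ⟨c, fun i => ?_⟩
  rw [add_comm, ← hz i]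
  by_cases hi : i ∈ S
  · have := hz₂ i
    simp only [η, if_pos hi] at this
    exact iff_of_true ⟨z i, ⟨mem_onePlusMaximalIdeal.mpr (hz₁ i), mem_onePlusMaximalIdeal.mpr this⟩,
      rfl⟩ hi
  · refine iff_of_false ?_ hi
    rintro ⟨u, ⟨hu₁, hu₂⟩, hu⟩
    rw [mem_onePlusMaximalIdeal] at hu₁ hu₂
    have hzη := hz₂ i
    simp only [η, if_neg hi] at hzη
    have hz1 : O₁.valuation (z i) = 1 := by
      have := valuation_one_add_eq_one (hz₁ i)
      rwa [add_sub_cancel] at this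
    have hzi : z i ≠ 0 := by
      intro h0
      rw [h0, map_zero] at hz1
      exact zero_ne_one hz1
    -- the first valuation identifies `u` with `z i`, the second then gives `ζ ≡ 1`
    have huz : u / z i = 1 := by
      refine eq_one_of_pow_eq_one hv₁ (by rw [div_pow, ← hu, div_self (pow_ne_zero _ hzi)]) ?_
      rw [div_sub_one hzi, map_div₀, hz1, div_one, ← sub_sub_sub_cancel_right u (z i) 1]
      exact Valuation.map_sub_lt _ hu₁ (hz₁ i)
    rw [div_eq_one_iff_eq hzi] at huz
    refine hζ.ne_one hp.one_lt (eq_one_of_pow_eq_one hv₂ hζ.pow_eq_one ?_)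
    rw [← sub_sub_sub_cancel_left _ _ (z i), ← huz]
    rw [← huz] at hzη
    exact Valuation.map_sub_lt _ hu₂ hzη

end Valuations

/-! ### The formula defining `x + y ∈ W` -/

section Formula

open FirstOrder FirstOrder.Language

variable {K : Type*} [Field K] {α : Type*}

/-- The term `s + t`. -/
abbrev addTerm {α : Type*} (s t : bivaluedLanguage.Term α) : bivaluedLanguage.Term α :=
  Functions.apply₂ (Sum.inl Ring.addFunc : bivaluedLanguage.Functions 2) s t

/-- The term `s * t`. -/
abbrev mulTerm {α : Type*} (s t : bivaluedLanguage.Term α) : bivaluedLanguage.Term α :=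
  Functions.apply₂ (Sum.inl Ring.mulFunc : bivaluedLanguage.Functions 2) s t

/-- The term `1`. -/
abbrev oneTerm {α : Type*} : bivaluedLanguage.Term α :=
  Constants.term (Sum.inl Ring.oneFunc : bivaluedLanguage.Constants)

/-- The term `t ^ n`, as an iterated product. -/
def powTerm {α : Type*} (t : bivaluedLanguage.Term α) : ℕ → bivaluedLanguage.Term α
  | 0 => oneTerm
  | n + 1 => mulTerm (powTerm t n) t

theorem realize_mulTerm (O₁ O₂ : ValuationSubring K) (s t : bivaluedLanguage.Term α) (v : α → K) :
    letI := bivaluedStructure O₁ O₂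
    (mulTerm s t).realize v = s.realize v * t.realize v := rfl

theorem realize_oneTerm (O₁ O₂ : ValuationSubring K) (v : α → K) :
    letI := bivaluedStructure O₁ O₂
    (oneTerm : bivaluedLanguage.Term α).realize v = (1 : K) := rfl

theorem realize_powTerm (O₁ O₂ : ValuationSubring K) (t : bivaluedLanguage.Term α) (v : α → K)
    (n : ℕ) :
    letI := bivaluedStructure O₁ O₂
    (powTerm t n).realize v = t.realize v ^ n := by
  let := bivaluedStructure O₁ O₂
  induction n with
  | zero => rw [pow_zero]; exact realize_oneTerm O₁ O₂ v
  | succ n ih => rw [pow_succ, ← ih]; exact realize_mulTerm O₁ O₂ _ _ v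

/-- The formula in one variable `u` saying that `u = 1 + w` for some `w` in the valuation ring named
by `R` that is not a unit of this ring. -/
def onePlusFormula (R : ValRel 1) : bivaluedLanguage.BoundedFormula α 1 :=
  ∃' (Relations.boundedFormula₁ (Sum.inr R : bivaluedLanguage.Relations 1) (&1) ⊓
    Term.bdEqual (&0) (addTerm oneTerm (&1)) ⊓
    ∀' ∼ (Relations.boundedFormula₁ (Sum.inr R : bivaluedLanguage.Relations 1) (&2) ⊓
      Term.bdEqual (mulTerm (&1) (&2)) oneTerm))

/-- The formula `φ(x; y)` saying that `x + y ∈ W`, that is, `x + y = u ^ p` for some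
`u ∈ (1 + 𝔪₁) ∩ (1 + 𝔪₂)`. -/
def pthPowersFormula (p : ℕ) : bivaluedLanguage.Formula (Fin 1 ⊕ Fin 1) :=
  ∃' (onePlusFormula ValRel.ring₁ ⊓ onePlusFormula ValRel.ring₂ ⊓
    Term.bdEqual (addTerm (Term.var (Sum.inl (Sum.inl 0))) (Term.var (Sum.inl (Sum.inr 0))))
      (powTerm (&0) p))

theorem mem_onePlusMaximalIdeal_iff_forall {O : ValuationSubring K} {u : K} :
    u ∈ onePlusMaximalIdeal O ↔
      ∃ w, (w ∈ O ∧ u = 1 + w) ∧ ∀ s, ¬ (s ∈ O ∧ w * s = 1) := by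
  constructor
  · rintro ⟨a, ha, rfl⟩
    refine ⟨a, ⟨a.2, rfl⟩, ?_⟩
    rintro s ⟨hs, h1⟩
    exact (IsLocalRing.mem_maximalIdeal a).mp ha
      (IsUnit.of_mul_eq_one (⟨s, hs⟩ : O) (Subtype.ext h1))
  · rintro ⟨w, ⟨hw, rfl⟩, h⟩
    refine ⟨⟨w, hw⟩, (IsLocalRing.mem_maximalIdeal _).mpr fun hu => ?_, rfl⟩
    obtain ⟨s, hs⟩ := hu.exists_right_inv
    exact h s ⟨s.2, congrArg Subtype.val hs⟩

theorem realize_onePlusFormula₁ (O₁ O₂ : ValuationSubring K) (v : α → K) (x : Fin 1 → K) :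
    letI := bivaluedStructure O₁ O₂
    (onePlusFormula ValRel.ring₁ : bivaluedLanguage.BoundedFormula α 1).Realize v x ↔
      x 0 ∈ onePlusMaximalIdeal O₁ := by
  let := bivaluedStructure O₁ O₂
  rw [mem_onePlusMaximalIdeal_iff_forall]
  simp only [onePlusFormula, BoundedFormula.realize_ex, BoundedFormula.realize_inf,
    BoundedFormula.realize_all, BoundedFormula.realize_not, BoundedFormula.realize_bdEqual]
  rfl

theorem realize_onePlusFormula₂ (O₁ O₂ : ValuationSubring K) (v : α → K) (x : Fin 1 → K) :
    letI := bivaluedStructure O₁ O₂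
    (onePlusFormula ValRel.ring₂ : bivaluedLanguage.BoundedFormula α 1).Realize v x ↔
      x 0 ∈ onePlusMaximalIdeal O₂ := by
  let := bivaluedStructure O₁ O₂
  rw [mem_onePlusMaximalIdeal_iff_forall]
  simp only [onePlusFormula, BoundedFormula.realize_ex, BoundedFormula.realize_inf,
    BoundedFormula.realize_all, BoundedFormula.realize_not, BoundedFormula.realize_bdEqual]
  rfl

theorem realize_pthPowersFormula (O₁ O₂ : ValuationSubring K) (p : ℕ)
    (v : Fin 1 ⊕ Fin 1 → K) :
    letI := bivaluedStructure O₁ O₂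
    (pthPowersFormula p).Realize v ↔ v (Sum.inl 0) + v (Sum.inr 0) ∈ pthPowers O₁ O₂ p := by
  let := bivaluedStructure O₁ O₂
  simp only [Formula.Realize, pthPowersFormula, BoundedFormula.realize_ex,
    BoundedFormula.realize_inf, BoundedFormula.realize_bdEqual, realize_onePlusFormula₁,
    realize_onePlusFormula₂, realize_powTerm, and_assoc, pthPowers, Set.mem_inter_iff]
  rfl

end Formula

end MultiValued

theorem mainTheorem4 {K : Type*} [Field K] [IsAlgClosed K]
    (O₁ O₂ : ValuationSubring K)
    (h₁ : O₁ ≠ ⊤) (h₂ : O₂ ≠ ⊤)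
    (hind : MultiValued.Independent O₁ O₂) :
    letI := MultiValued.bivaluedStructure O₁ O₂
    (¬ MultiValued.IsNIP MultiValued.bivaluedLanguage K) ∧
    MultiValued.HasIP MultiValued.bivaluedLanguage K ∧
    ∀ p : ℕ, p.Prime → p ≠ ringChar K →
      p ≠ ringChar (IsLocalRing.ResidueField O₁) →
      p ≠ ringChar (IsLocalRing.ResidueField O₂) →
      ∃ φ : MultiValued.bivaluedLanguage.Formula (Fin 1 ⊕ Fin 1),
        (∀ x y : K, φ.Realize (Sum.elim ![x] ![y]) ↔
          x + y ∈ MultiValued.pthPowers O₁ O₂ p) ∧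
        MultiValued.FormulaHasIP MultiValued.bivaluedLanguage K φ := by
  let := MultiValued.bivaluedStructure O₁ O₂
  have key : ∀ p : ℕ, p.Prime → p ≠ ringChar (IsLocalRing.ResidueField O₁) →
      p ≠ ringChar (IsLocalRing.ResidueField O₂) →
      MultiValued.FormulaHasIP MultiValued.bivaluedLanguage K
        (MultiValued.pthPowersFormula p) := by
    intro p hp hp₁ hp₂ k
    obtain ⟨a, b, hab⟩ := MultiValued.exists_shattered_pthPowers h₁ h₂ hind hp hp₁ hp₂ k
    refine ⟨fun i => ![a i], fun S => ![b S], fun S i => ?_⟩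
    rw [← hab S i]
    exact MultiValued.realize_pthPowersFormula O₁ O₂ p _
  obtain ⟨p, hpN, hp⟩ := Nat.exists_infinite_primes
    (ringChar (IsLocalRing.ResidueField O₁) + ringChar (IsLocalRing.ResidueField O₂) + 1)
  have hIP := key p hp (by omega) (by omega)
  exact ⟨fun h => h _ _ _ hIP, ⟨_, _, _, hIP⟩, fun p hp _ hp₁ hp₂ =>
    ⟨MultiValued.pthPowersFormula p,
      fun x y => MultiValued.realize_pthPowersFormula O₁ O₂ p _, key p hp hp₁ hp₂⟩⟩
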